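/- Let $n\ge 1$, let $\mathbb{B}_n$ be the open unit ball of $\mathbb{C}^n$ for the hermitian norm, and let $S_1,\dots,S_n$ be the left creation operators $S_j(e_{i_1}\otimes\cdots\otimes e_{i_m})=e_j\otimes e_{i_1}\otimes\cdots\otimes e_{i_m}$, $S_j(1)=e_j$, on the full Fock space $\mathbb{C}\oplus\mathbb{C}^n\oplus(\mathbb{C}^n)^{\otimes 2}\oplus\cdots$. Let $F_n^\infty$ be the closure, in the weak operator topology, of the unital algebra generated by $S_1,\dots,S_n$, with its weak* topology as a dual space. For $z\in\mathbb{B}_n$ let $\varphi\mapsto\varphi(z)$ denote the unique weak* continuous unital algebra homomorphism $F_n^\infty\to\mathbb{C}$ with $S_j\mapsto z_j$ for $j=1,\dots,n$. For $\Delta\subseteq\mathbb{B}_n$ put $\mathcal{N}_\Delta=\{\varphi\in F_n^\infty:\varphi(z)=0\text{ for all }z\in\Delta\}$. Give $F_n^\infty/\mathcal{N}_\Delta$ the weak* topology it carries as the dual of the polar of $\mathcal{N}_\Delta$ in the predual of $F_n^\infty$. Let the spectrum $\Sigma(F_n^\infty/\mathcal{N}_\Delta)$ be the set of all weak* continuous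 unital algebra homomorphisms $\pi:F_n^\infty/\mathcal{N}_\Delta\to\mathbb{C}$, with the topology of pointwise convergence. The spectral closure $\overline{\Delta}^{\Sigma}$ of $\Delta$ is this spectrum viewed in $\mathbb{C}^n$, that is, the set of the points $(\pi(S_1+\mathcal{N}_\Delta),\dots,\pi(S_n+\mathcal{N}_\Delta))$ with $\pi\in\Sigma(F_n^\infty/\mathcal{N}_\Delta)$. Let $\Delta=\{\lambda_j : j\in I\}\subseteq\mathbb{B}_n$ be a finite or infinite family such that $$\sum_{j\in I}\left(1-\|\lambda_j\|_{\mathbb{C}^n}\right)<\infty .$$ Then the spectrum of $F_n^\infty/\mathcal{N}_\Delta$ is $\Delta$: for each $z\in\Delta$ the map $\varphi+\mathcal{N}_\Delta\mapsto\varphi(z)$ is a well-defined element of $\Sigma(F_n^\infty/\mathcal{N}_\Delta)$, and sending $z$ to this element is a homeomorphism of $\Delta$ onto $\Sigma(F_n^\infty/\mathcal{N}_\Delta)$. Equivalently, $\overline{\Delta}^{\Sigma}=\Delta$. -/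

import Mathlib

noncomputable section

namespace NCHardy

/-- `ℂⁿ` with its hermitian norm. -/
abbrev Cn (n : ℕ) : Type := EuclideanSpace ℂ (Fin n)

/-- The open unit ball `𝔹ₙ` of `ℂⁿ`. -/
abbrev Ball (n : ℕ) : Type := Metric.ball (0 : Cn n) 1

/-- The full Fock space over `ℂⁿ`, in its canonical orthonormal basis: the word
`[i₁, …, iₘ]` stands for `e_{i₁} ⊗ ⋯ ⊗ e_{iₘ}` and the empty word for `1 ∈ ℂ`. -/
abbrev Fock (n : ℕ) : Type := lp (fun _ : List (Fin n) => ℂ) 2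

/-- The basis vector `e_{i₁} ⊗ ⋯ ⊗ e_{iₘ}` of the word `w = [i₁, …, iₘ]`. -/
def basisVec {n : ℕ} (w : List (Fin n)) : Fock n := lp.single 2 w 1

lemma orthonormal_basisVec (n : ℕ) : Orthonormal ℂ (basisVec (n := n)) := by
  classical
  rw [orthonormal_iff_ite]
  intro v w
  rw [basisVec, lp.inner_single_left, basisVec, lp.coeFn_single]
  by_cases h : v = w
  · subst h; simp
  · simp [h]

lemma orthogonalFamily_shift {n : ℕ} (j : Fin n) :
    OrthogonalFamily ℂ (fun _ : List (Fin n) => ℂ)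
      (fun w => LinearIsometry.toSpanSingleton ℂ (Fock n)
        ((orthonormal_basisVec n).1 (j :: w))) :=
  ((orthonormal_basisVec n).comp (List.cons j) List.cons_injective).orthogonalFamily

/-- The left creation operator `S_j`: the bounded operator that sends the basis vector of the
word `w` to that of the word `j :: w`. -/
def creation {n : ℕ} (j : Fin n) : Fock n →L[ℂ] Fock n :=
  (orthogonalFamily_shift j).linearIsometry.toContinuousLinearMap

lemma creation_basisVec {n : ℕ} (j : Fin n) (w : List (Fin n)) :
    creation j (basisVec w) = basisVec (j :: w) := by
  change (orthogonalFamily_shift j).linearIsometry (lp.single 2 w 1) = _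
  rw [OrthogonalFamily.linearIsometry_apply_single]
  simp

/-- The noncommutative Hardy algebra `Fₙ^∞`: the closure, in the weak operator topology, of the
unital algebra generated by the left creation operators. -/
def hardy (n : ℕ) : Subalgebra ℂ (Fock n →L[ℂ] Fock n) :=
  (Algebra.adjoin ℂ (Set.range fun j : Fin n =>
      (ContinuousLinearMapWOT.ofCLM (creation j) : Fock n →WOT[ℂ] Fock n))).topologicalClosure.comap
    (ContinuousLinearMapWOT.algEquiv ℂ).symm.toAlgHom

lemma creation_mem {n : ℕ} (j : Fin n) : creation j ∈ hardy n :=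
  Subalgebra.le_topologicalClosure _ (Algebra.subset_adjoin ⟨j, rfl⟩)

/-- The generator `S_j` as an element of `Fₙ^∞`. -/
def gen {n : ℕ} (j : Fin n) : hardy n := ⟨creation j, creation_mem j⟩

/-- The monomial `z^w = z_{i₁} ⋯ z_{iₘ}` for the word `w = [i₁, …, iₘ]`. -/
def monomial {n : ℕ} (z : Cn n) (w : List (Fin n)) : ℂ := (w.map fun j => z j).prod

lemma memLp_monomial {n : ℕ} (z : Ball n) :
    Memℓp (fun w : List (Fin n) => star (monomial z.1 w)) 2 := by
  have hz : ∑ j, ‖z.1 j‖ ^ 2 < 1 := by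
    have h := z.2
    rw [mem_ball_zero_iff, EuclideanSpace.norm_eq, Real.sqrt_lt' one_pos] at h
    simpa using h
  refine memℓp_gen ?_
  suffices h : Summable fun w : List (Fin n) => (w.map fun j => ‖z.1 j‖ ^ 2).prod by
    refine h.congr fun w => ?_
    simp only [monomial, norm_star, ENNReal.toReal_ofNat, Real.rpow_ofNat]
    induction w with
    | nil => simp
    | cons a w ih => simp [mul_pow, ih]
  rw [← List.equivSigmaTuple.symm.summable_iff]
  have key : ∀ k : ℕ, ∀ f : Fin k → Fin n,
      ((List.ofFn f).map fun j => ‖z.1 j‖ ^ 2).prod = ∏ i, ‖z.1 (f i)‖ ^ 2 := by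
    intro k f
    rw [List.map_ofFn, List.prod_ofFn]
    rfl
  refine (summable_sigma_of_nonneg fun p => ?_).2 ⟨fun k => Summable.of_finite, ?_⟩
  · exact List.prod_nonneg (by simp only [List.mem_map]; rintro _ ⟨j, -, rfl⟩; positivity)
  · refine (summable_geometric_of_lt_one (by positivity) hz).congr fun k => ?_
    rw [tsum_fintype, Fintype.sum_pow]
    exact Finset.sum_congr rfl fun f _ => (key k f).symm

/-- The vector `∑_w conj(z^w) e_w` of the Fock space, for `z ∈ 𝔹ₙ`. -/
def kernelVec {n : ℕ} (z : Ball n) : Fock n :=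
  ⟨fun w => star (monomial z.1 w), memLp_monomial z⟩

lemma inner_kernelVec_basisVec {n : ℕ} (z : Ball n) (w : List (Fin n)) :
    inner ℂ (kernelVec z) (basisVec w) = monomial z.1 w := by
  rw [basisVec, lp.inner_single_right]
  simp [kernelVec]

lemma ext_basisVec {n : ℕ} {f g : Fock n →L[ℂ] ℂ}
    (h : ∀ w, f (basisVec w) = g (basisVec w)) : f = g := by
  ext x
  have hx := lp.hasSum_single (p := 2) (by simp) x
  have h1 : ∀ w, lp.single 2 w (x w) = x w • basisVec w := by
    intro w
    rw [basisVec, ← lp.single_smul]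
    simp
  simp only [h1] at hx
  refine (hx.mapL f).unique ?_
  simpa [h] using hx.mapL g

lemma inner_kernelVec_creation {n : ℕ} (z : Ball n) (j : Fin n) (x : Fock n) :
    inner ℂ (kernelVec z) (creation j x) = z.1 j * inner ℂ (kernelVec z) x := by
  have : (innerSL ℂ (kernelVec z)).comp (creation j) = z.1 j • innerSL ℂ (kernelVec z) := by
    refine ext_basisVec fun w => ?_
    simp [creation_basisVec, inner_kernelVec_basisVec, monomial]
  simpa using DFunLike.congr_fun this x

lemma inner_kernelVec_apply {n : ℕ} (z : Ball n) (φ : hardy n) (x : Fock n) :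
    inner ℂ (kernelVec z) (φ.1 x) =
      inner ℂ (kernelVec z) (φ.1 (basisVec [])) * inner ℂ (kernelVec z) x := by
  let P : Set (Fock n →WOT[ℂ] Fock n) := {T | ∀ x, inner ℂ (kernelVec z) (T x) =
      inner ℂ (kernelVec z) (T (basisVec [])) * inner ℂ (kernelVec z) x}
  have hcl : IsClosed P := by
    simp only [P, Set.ofPred_forall]
    refine isClosed_iInter fun x => isClosed_eq ?_ ?_
    · exact ContinuousLinearMapWOT.continuous_iff.1 continuous_id x _
    · exact (ContinuousLinearMapWOT.continuous_iff.1 continuous_id _ _).mul continuous_const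
  have h0 : inner ℂ (kernelVec z) (basisVec ([] : List (Fin n))) = 1 := by
    rw [inner_kernelVec_basisVec]; simp [monomial]
  have hsub : ∀ T ∈ Algebra.adjoin ℂ (Set.range fun j : Fin n =>
      (ContinuousLinearMapWOT.ofCLM (creation j) : Fock n →WOT[ℂ] Fock n)), T ∈ P := by
    intro T hT
    induction hT using Algebra.adjoin_induction with
    | mem T hT =>
      obtain ⟨j, rfl⟩ := hT
      intro x
      simp [inner_kernelVec_creation, h0]
    | algebraMap c => intro x; simp [h0]
    | add S T _ _ hS hT =>
      intro x
      simp only [ContinuousLinearMapWOT.add_apply, inner_add_right]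
      rw [hS x, hT x, add_mul]
    | mul S T _ _ hS hT =>
      intro x
      simp only [ContinuousLinearMapWOT.mul_apply]
      rw [hS (T x), hT x, hS (T _), mul_assoc]
  exact closure_minimal (fun T hT => hsub T hT) hcl φ.2 x

/-- The point evaluation `φ ↦ φ(z)` at `z ∈ 𝔹ₙ`: the unital homomorphism `π_z : Fₙ^∞ → ℂ`
with `π_z(S_j) = z_j`, that is `φ(z) = ∑_w a_w z^w` where `φ(1) = ∑_w a_w e_w`. -/
def eval {n : ℕ} (z : Ball n) : hardy n →ₐ[ℂ] ℂ where
  toFun φ := inner ℂ (kernelVec z) (φ.1 (basisVec []))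
  map_one' := by simp [inner_kernelVec_basisVec, monomial]
  map_mul' φ ψ := inner_kernelVec_apply z φ (ψ.1 (basisVec []))
  map_zero' := by simp
  map_add' φ ψ := by simp
  commutes' c := by
    simp [Algebra.algebraMap_eq_smul_one, inner_kernelVec_basisVec, monomial]

lemma eval_gen {n : ℕ} (z : Ball n) (j : Fin n) : eval z (gen j) = z.1 j := by
  change inner ℂ (kernelVec z) (creation j (basisVec [])) = _
  simp [creation_basisVec, inner_kernelVec_basisVec, monomial]

/-- The predual of `Fₙ^∞`, as a set of linear functionals: the restrictions of the
normal functionals `T ↦ ∑ₖ ⟨T xₖ, yₖ⟩` with `∑ ‖xₖ‖² < ∞` and `∑ ‖yₖ‖² < ∞` (equivalently, of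
`T ↦ tr(TA)` with `A` of trace class). -/
def predual (n : ℕ) : Set (hardy n →ₗ[ℂ] ℂ) :=
  {f | ∃ x y : ℕ → Fock n, (Summable fun k => ‖x k‖ ^ 2) ∧ (Summable fun k => ‖y k‖ ^ 2) ∧
    ∀ φ : hardy n, f φ = ∑' k, inner ℂ (y k) (φ.1 (x k))}

/-- The weak* topology of `Fₙ^∞ / J`, as the dual of the polar of `J` in the predual of `Fₙ^∞`:
the coarsest topology for which the functionals on `Fₙ^∞ / J` induced by the elements of the
predual that vanish on `J` are continuous. -/
@[reducible] def weakStar {n : ℕ} (J : Ideal (hardy n)) [J.IsTwoSided] : TopologicalSpace (hardy n ⧸ J) :=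
  ⨅ g ∈ {g : (hardy n ⧸ J) →ₗ[ℂ] ℂ | g ∘ₗ (Ideal.Quotient.mkₐ ℂ J).toLinearMap ∈ predual n},
    TopologicalSpace.induced g inferInstance

/-- The spectrum `Σ(Fₙ^∞ / J)`: the weak* continuous unital algebra homomorphisms to `ℂ`. -/
def Spec {n : ℕ} (J : Ideal (hardy n)) [J.IsTwoSided] : Type :=
  {π : (hardy n ⧸ J) →ₐ[ℂ] ℂ // @Continuous _ _ (weakStar J) inferInstance π}

/-- The spectrum carries the weak* topology of the dual of `Fₙ^∞ / J`, which is the topology of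
pointwise convergence. -/
instance instTopSpec {n : ℕ} (J : Ideal (hardy n)) [J.IsTwoSided] : TopologicalSpace (Spec J) :=
  TopologicalSpace.induced (fun π (a : hardy n ⧸ J) => π.1 a) inferInstance

/-- The Nevanlinna ideal `𝒩_Δ = {φ ∈ Fₙ^∞ : φ(z) = 0 for all z ∈ Δ}`. -/
def nevanlinna {n : ℕ} (Δ : Set (Ball n)) : Ideal (hardy n) where
  carrier := {φ | ∀ z ∈ Δ, eval z φ = 0}
  zero_mem' := by simp
  add_mem' := by
    intro a b ha hb z hz
    have h : eval z (a + b) = eval z a + eval z b := (eval z).map_add' a b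
    rw [ha z hz, hb z hz, add_zero] at h
    exact h
  smul_mem' := by
    intro c a ha z hz
    have h := map_mul (eval z) c a
    rw [ha z hz, mul_zero] at h
    exact h

instance nevanlinna_isTwoSided {n : ℕ} (Δ : Set (Ball n)) : (nevanlinna Δ).IsTwoSided :=
  ⟨fun {a} b ha z hz => by
    have h := map_mul (eval z) a b
    rw [ha z hz, zero_mul] at h
    exact h⟩

/-- The spectral closure of `Δ`: the spectrum of `Fₙ^∞ / 𝒩_Δ`, each `π` in it being identified
with the point `(π(S₁ + 𝒩_Δ), …, π(Sₙ + 𝒩_Δ))` of `ℂⁿ`. -/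
def spectralClosure {n : ℕ} (Δ : Set (Ball n)) : Set (Cn n) :=
  {z | ∃ π : Spec (nevanlinna Δ), ∀ j, π.1 (Ideal.Quotient.mk _ (gen j)) = z j}

end NCHardy

end

/-!
A weak* continuous character `ρ` of `Fₙ^∞` is the evaluation at `z = (ρ(S₁), …, ρ(Sₙ))`. The point
`z` lies in the open ball because the powers of a linear form `∑ j, conj (c j) S_j` with `‖c‖ ≤ 1`
tend weak* to `0`, so `⟪c, z⟫ ^ m` tends to `0`. Every `φ` in `Fₙ^∞` can be written as
`φ = φ(z) + ∑ j, (S_j - z_j) χ_j`, so a character is determined by its values at the generators,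
continuous or not. Hence the spectrum of `Fₙ^∞ / J` is the common zero set of `J` in the ball.

It remains to find, for `z ∉ Δ`, an element of `𝒩_Δ` that does not vanish at `z`. For each `λ_j` the
operator Möbius transform of a linear form is a contraction that vanishes at `λ_j` and whose value
at `z` is not `0` and has modulus at least `1 - C (1 - ‖λ_j‖)`, where `C` depends on `z` only. The
finite products of these contractions have a cluster point in the weak operator topology; it
vanishes on `Δ`, and the Blaschke condition keeps its value at `z` away from `0`.
-/

namespace NCHardy

open Filter Topology ComplexConjugate
open scoped InnerProductSpace

section HilbertSpace

variable {𝕜 H α : Type*} [RCLike 𝕜] [NormedAddCommGroup H] [InnerProductSpace 𝕜 H]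

lemma exists_norm_le_one_inner_eq_norm [CompleteSpace H] (v : H) :
    ∃ c : H, ‖c‖ ≤ 1 ∧ ⟪c, v⟫_𝕜 = ‖v‖ := by
  obtain ⟨f, hf, hfv⟩ := exists_dual_vector'' 𝕜 v
  exact ⟨(InnerProductSpace.toDual 𝕜 H).symm f, by simpa using hf, by simpa using hfv⟩

lemma exists_forall_tendsto_inner [CompleteSpace H] (U : Ultrafilter α) {x : α → H} {C : ℝ}
    (hx : ∀ a, ‖x a‖ ≤ C) :
    ∃ y : H, ‖y‖ ≤ C ∧ ∀ v, Tendsto (fun a => ⟪v, x a⟫_𝕜) U (𝓝 ⟪v, y⟫_𝕜) := by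
  let f : α → WeakDual 𝕜 H := fun a =>
    StrongDual.toWeakDual (InnerProductSpace.toDual 𝕜 H (x a))
  obtain ⟨g, hg, hfg⟩ := (WeakDual.isCompact_closedBall (𝕜 := 𝕜) (0 : StrongDual 𝕜 H) C)
    |>.ultrafilter_le_nhds' (U.map f) (Ultrafilter.mem_map.2 <| univ_mem' fun a => by
      simpa [f] using hx a)
  refine ⟨(InnerProductSpace.toDual 𝕜 H).symm (WeakDual.toStrongDual g), by simpa using hg,
    fun v => ?_⟩
  have hlim : Tendsto (fun a => ⟪x a, v⟫_𝕜) U (𝓝 (g v)) :=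
    ((WeakDual.eval_continuous v).tendsto g).comp hfg
  rw [← inner_conj_symm, InnerProductSpace.toDual_symm_apply]
  exact ((RCLike.continuous_conj.tendsto _).comp hlim).congr fun a => inner_conj_symm _ _

lemma exists_forall_tendsto_inner_apply [CompleteSpace H] (U : Ultrafilter α)
    {T : α → H →L[𝕜] H} {C : ℝ} (hT : ∀ a, ‖T a‖ ≤ C) :
    ∃ S : H →L[𝕜] H, ∀ v x, Tendsto (fun a => ⟪v, T a x⟫_𝕜) U (𝓝 ⟪v, S x⟫_𝕜) := by
  choose S hSC hS using fun x : H => exists_forall_tendsto_inner (𝕜 := 𝕜) U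
    fun a => (T a).le_of_opNorm_le (hT a) x
  let L : H →ₗ[𝕜] H :=
    { toFun := S
      map_add' := fun x y => ext_inner_left 𝕜 fun v => tendsto_nhds_unique (hS (x + y) v) <| by
        simpa only [map_add, inner_add_right] using (hS x v).add (hS y v)
      map_smul' := fun c x => ext_inner_left 𝕜 fun v => tendsto_nhds_unique (hS (c • x) v) <| by
        simpa only [map_smul, inner_smul_right, RingHom.id_apply] using
          (hS x v).const_mul c }
  exact ⟨L.mkContinuous C hSC, fun v x => hS x v⟩

lemma norm_smul_sub_le_norm_sub_conj_smul {a : 𝕜} (ha : ‖a‖ ≤ 1) {x y : H} (h : ‖y‖ ≤ ‖x‖) :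
    ‖a • x - y‖ ≤ ‖x - conj a • y‖ := by
  have hinner : ⟪a • x, y⟫_𝕜 = ⟪x, conj a • y⟫_𝕜 := by rw [inner_smul_left, inner_smul_right]
  have ha' : ‖a‖ ^ 2 ≤ 1 := pow_le_one₀ (norm_nonneg a) ha
  have h' : ‖y‖ ^ 2 ≤ ‖x‖ ^ 2 := by gcongr
  refine (sq_le_sq₀ (norm_nonneg _) (norm_nonneg _)).1 ?_
  rw [norm_sub_sq (𝕜 := 𝕜), norm_sub_sq (𝕜 := 𝕜), hinner, norm_smul, norm_smul, RCLike.norm_conj]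
  nlinarith

lemma exists_mul_one_sub_conj_smul_eq {A : Subalgebra 𝕜 (H →L[𝕜] H)}
    [CompleteSpace A] {T : A} (hT : ‖T‖ ≤ 1) {a : 𝕜} (ha : ‖a‖ < 1) :
    ∃ b : A, ‖b‖ ≤ 1 ∧ b * (1 - conj a • T) = algebraMap 𝕜 A a - T := by
  have hlt : ‖conj a • T‖ < 1 := by
    refine (norm_smul (conj a) T.1).trans_lt ?_
    rw [RCLike.norm_conj]
    exact mul_lt_one_of_nonneg_of_lt_one_left (norm_nonneg a) ha hT
  obtain ⟨u, hu⟩ := isUnit_one_sub_of_norm_lt_one hlt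
  refine ⟨(algebraMap 𝕜 A a - T) * ↑u⁻¹, ?_, by rw [← hu, Units.inv_mul_cancel_right]⟩
  refine ContinuousLinearMap.opNorm_le_bound _ zero_le_one fun x => ?_
  set y : H := (↑u⁻¹ : A).1 x with hy
  have hxy : y - conj a • T.1 y = x := by
    have h : (1 - conj a • T) * (↑u⁻¹ : A) = 1 := by rw [← hu, Units.mul_inv]
    simpa using congr($(h).1 x)
  have hTy : ‖T.1 y‖ ≤ ‖y‖ := by simpa using T.1.le_of_opNorm_le hT y
  calc ‖((algebraMap 𝕜 A a - T) * ↑u⁻¹ : A).1 x‖ = ‖a • y - T.1 y‖ := by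
        simp [hy, Algebra.algebraMap_eq_smul_one]
    _ ≤ ‖y - conj a • T.1 y‖ := norm_smul_sub_le_norm_sub_conj_smul ha.le hTy
    _ = 1 * ‖x‖ := by rw [hxy, one_mul]

end HilbertSpace

lemma exists_pos_forall_le_prod {ι : Type*} {t : ι → ℝ} (ht0 : ∀ i, 0 < t i)
    (ht1 : ∀ i, t i ≤ 1) (h : Summable fun i => 1 - t i) :
    ∃ δ > 0, ∀ s : Finset ι, δ ≤ ∏ i ∈ s, t i := by
  have hlog : Summable fun i => Real.log (t i) := by
    simpa using Real.summable_log_one_add_of_summable h.neg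
  refine ⟨Real.exp (∑' i, Real.log (t i)), Real.exp_pos _, fun s => ?_⟩
  calc Real.exp (∑' i, Real.log (t i)) ≤ Real.exp (∑ i ∈ s, Real.log (t i)) := by
        have := hlog.neg.sum_le_tsum s fun i _ =>
          neg_nonneg.2 (Real.log_nonpos (ht0 i).le (ht1 i))
        rw [tsum_neg, Finset.sum_neg_distrib] at this
        exact Real.exp_le_exp.2 (neg_le_neg_iff.1 this)
    _ = ∏ i ∈ s, t i := by
        rw [Real.exp_sum]
        exact Finset.prod_congr rfl fun i _ => Real.exp_log (ht0 i)

lemma one_sub_norm_le_of_mul_one_sub_eq {β t : ℂ} {r s : ℝ} (hr0 : 0 ≤ r) (hr1 : r ≤ 1)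
    (ht : ‖t‖ ≤ s) (hs : s < 1) (h : β * (1 - r * t) = r - t) :
    1 - ‖β‖ ≤ 2 / (1 - s) * (1 - r) := by
  have hrt : ‖r * t‖ ≤ s := by
    rw [norm_mul, Complex.norm_real, Real.norm_of_nonneg hr0]
    exact (mul_le_of_le_one_left (norm_nonneg t) hr1).trans ht
  have hden : 1 - s ≤ ‖1 - r * t‖ := by
    simpa using (sub_le_sub_left hrt 1).trans (by simpa using norm_sub_norm_le 1 (r * t))
  have hnum : ‖1 - β‖ * ‖1 - r * t‖ ≤ 2 * (1 - r) := by
    have h' : (1 - β) * (1 - r * t) = ((1 - r : ℝ) : ℂ) * (1 + t) := by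
      push_cast
      linear_combination -h
    rw [← norm_mul, h', norm_mul, Complex.norm_real, Real.norm_of_nonneg (by linarith), mul_comm]
    have : ‖1 + t‖ ≤ 2 := (norm_add_le 1 t).trans (by rw [norm_one]; linarith)
    gcongr
  have hβ : 1 - ‖β‖ ≤ ‖1 - β‖ := by simpa using norm_sub_norm_le 1 β
  rw [div_mul_eq_mul_div, le_div_iff₀ (by linarith)]
  calc (1 - ‖β‖) * (1 - s) ≤ ‖1 - β‖ * ‖1 - r * t‖ := by gcongr
    _ ≤ 2 * (1 - r) := hnum

lemma summable_norm_mul_norm {E ι : Type*} [SeminormedAddCommGroup E] {x y : ι → E}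
    (hx : Summable fun k => ‖x k‖ ^ 2) (hy : Summable fun k => ‖y k‖ ^ 2) :
    Summable fun k => ‖x k‖ * ‖y k‖ :=
  Real.summable_mul_of_Lp_Lq_of_nonneg Real.HolderConjugate.two_two (fun _ => norm_nonneg _)
    (fun _ => norm_nonneg _) (by simpa using hx) (by simpa using hy)

lemma exists_sub_apply_eq_of_summable_iterate {R E : Type*} [Semiring R] [AddCommGroup E]
    [TopologicalSpace E] [IsTopologicalAddGroup E] [T2Space E] [Module R E] (B : E →L[R] E) {x : E}
    (h : Summable fun m => B^[m] x) : ∃ y, y - B y = x := by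
  refine ⟨∑' m, B^[m] x, ?_⟩
  rw [B.map_tsum h, h.tsum_eq_zero_add]
  simp only [Function.iterate_succ_apply', Function.iterate_zero, id_eq, add_sub_cancel_right]

lemma map_algebraMap_add_sum_sub_mul {R A ι : Type*} [CommRing R] [Ring A] [Algebra R A] [Fintype ι]
    (ρ : A →ₐ[R] R) (c : R) (z : ι → R) (g χ : ι → A) :
    ρ (algebraMap R A c + ∑ j, (g j - algebraMap R A (z j)) * χ j) =
      c + ∑ j, (ρ (g j) - z j) * ρ (χ j) := by
  simp

variable {n : ℕ}

/-! ### Creation operators and linear forms -/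

lemma inner_basisVec (w : List (Fin n)) (x : Fock n) : ⟪basisVec w, x⟫_ℂ = x w := by
  rw [basisVec, lp.inner_single_left]
  simp

lemma creation_apply_nil (j : Fin n) (x : Fock n) : creation j x [] = 0 := by
  have h : (innerSL ℂ (basisVec ([] : List (Fin n)))).comp (creation j) = 0 :=
    ext_basisVec fun w => by
      simpa [creation_basisVec] using
        orthonormal_iff_ite.1 (orthonormal_basisVec n) [] (j :: w)
  rw [← inner_basisVec]
  exact congr($h x)

lemma creation_apply_cons (i j : Fin n) (x : Fock n) (w : List (Fin n)) :
    creation j x (i :: w) = if i = j then x w else 0 := by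
  have h : (innerSL ℂ (basisVec (i :: w))).comp (creation j) =
      (if i = j then 1 else 0 : ℂ) • innerSL ℂ (basisVec w) :=
    ext_basisVec fun v => by
      have hij := orthonormal_iff_ite.1 (orthonormal_basisVec n) (i :: w) (j :: v)
      have hwv := orthonormal_iff_ite.1 (orthonormal_basisVec n) w v
      simp only [List.cons.injEq] at hij
      by_cases h : i = j <;> simp_all [creation_basisVec]
  have hx : ⟪basisVec (i :: w), creation j x⟫_ℂ = (if i = j then 1 else 0) * ⟪basisVec w, x⟫_ℂ :=
    congr($h x)
  simpa [inner_basisVec] using hx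

lemma adjoint_creation_apply (j : Fin n) (x : Fock n) (w : List (Fin n)) :
    (creation j).adjoint x w = x (j :: w) := by
  rw [← inner_basisVec, ContinuousLinearMap.adjoint_inner_right, creation_basisVec, inner_basisVec]

lemma adjoint_creation_creation (i j : Fin n) (x : Fock n) :
    (creation i).adjoint (creation j x) = if i = j then x else 0 := by
  ext w
  rw [adjoint_creation_apply, creation_apply_cons]
  split_ifs <;> rfl

lemma norm_creation_apply (j : Fin n) (x : Fock n) : ‖creation j x‖ = ‖x‖ :=
  (orthogonalFamily_shift j).linearIsometry.norm_map x

lemma norm_sum_creation_sq (x : Fin n → Fock n) :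
    ‖∑ j, creation j (x j)‖ ^ 2 = ∑ j, ‖x j‖ ^ 2 := by
  have hortho : OrthogonalFamily ℂ (fun _ : Fin n => Fock n)
      fun j => (orthogonalFamily_shift j).linearIsometry := fun i j hij x y => by
    change ⟪creation i x, creation j y⟫_ℂ = 0
    rw [← ContinuousLinearMap.adjoint_inner_right, adjoint_creation_creation, if_neg hij,
      inner_zero_right]
  exact hortho.norm_sum x Finset.univ

lemma sum_creation_adjoint_creation {x : Fock n} (hx : x [] = 0) :
    ∑ j, creation j ((creation j).adjoint x) = x := by
  refine lp.ext (funext fun w => ?_)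
  rw [lp.coeFn_sum, Finset.sum_apply]
  cases w with
  | nil => simp only [creation_apply_nil, Finset.sum_const_zero, hx]
  | cons i w => simp [creation_apply_cons, adjoint_creation_apply]

lemma norm_adjoint_creation_apply_le (j : Fin n) (x : Fock n) :
    ‖(creation j).adjoint x‖ ≤ ‖x‖ := by
  refine (ContinuousLinearMap.le_of_opNorm_le _ (c := 1) ?_ x).trans_eq (one_mul _)
  rw [LinearIsometryEquiv.norm_map]
  exact (creation j).opNorm_le_bound zero_le_one fun y => by rw [norm_creation_apply, one_mul]

/-- The element `∑ j, conj (z j) S_j` of `Fₙ^∞`, whose value at a point `w` is `⟪z, w⟫`. -/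
noncomputable def linearForm (z : Cn n) : hardy n := ∑ j, conj (z j) • gen j

lemma linearForm_apply (z : Cn n) (x : Fock n) :
    (linearForm z).1 x = ∑ j, creation j (conj (z j) • x) := by
  simp [linearForm, gen]

lemma norm_linearForm_apply (z : Cn n) (x : Fock n) : ‖(linearForm z).1 x‖ = ‖z‖ * ‖x‖ := by
  rw [← sq_eq_sq₀ (norm_nonneg _) (by positivity), linearForm_apply, norm_sum_creation_sq, mul_pow,
    EuclideanSpace.norm_sq_eq, Finset.sum_mul]
  simp only [norm_smul, mul_pow, RCLike.norm_conj]

lemma norm_linearForm_le (z : Cn n) : ‖linearForm z‖ ≤ ‖z‖ :=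
  ContinuousLinearMap.opNorm_le_bound _ (norm_nonneg _) fun x => (norm_linearForm_apply z x).le

lemma map_linearForm (ρ : hardy n →ₐ[ℂ] ℂ) {w : Cn n} (hw : ∀ j, ρ (gen j) = w j) (z : Cn n) :
    ρ (linearForm z) = ⟪z, w⟫_ℂ := by
  simp only [linearForm, map_sum, PiLp.inner_apply]
  refine Finset.sum_congr rfl fun j _ => ?_
  rw [← hw, RCLike.inner_apply, mul_comm]
  exact ρ.toLinearMap.map_smul _ _

lemma norm_linearForm_pow_apply_le {z : Cn n} (hz : ‖z‖ ≤ 1) (m : ℕ) (x : Fock n) :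
    ‖(linearForm z ^ m).1 x‖ ≤ ‖x‖ := by
  induction m with
  | zero => simp
  | succ m ih =>
    rw [pow_succ']
    refine (norm_linearForm_apply z ((linearForm z ^ m).1 x)).trans_le ?_
    exact (mul_le_of_le_one_left (norm_nonneg _) hz).trans ih

lemma linearForm_apply_nil (z : Cn n) (x : Fock n) : (linearForm z).1 x [] = 0 := by
  rw [linearForm_apply, lp.coeFn_sum, Finset.sum_apply]
  exact Finset.sum_eq_zero fun j _ => creation_apply_nil j _

lemma linearForm_apply_cons (z : Cn n) (x : Fock n) (i : Fin n) (w : List (Fin n)) :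
    (linearForm z).1 x (i :: w) = conj (z i) * x w := by
  rw [linearForm_apply, lp.coeFn_sum, Finset.sum_apply]
  simp [creation_apply_cons]

lemma linearForm_pow_apply_eq_zero (z : Cn n) (x : Fock n) {m : ℕ} {w : List (Fin n)}
    (hw : w.length < m) : (linearForm z ^ m).1 x w = 0 := by
  induction m generalizing w with
  | zero => simp at hw
  | succ m ih =>
    rw [pow_succ']
    cases w with
    | nil => exact linearForm_apply_nil z _
    | cons i w =>
      refine (linearForm_apply_cons z ((linearForm z ^ m).1 x) i w).trans ?_
      rw [ih (by simpa using hw), mul_zero]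

lemma tendsto_inner_linearForm_pow {z : Cn n} (hz : ‖z‖ ≤ 1) (x y : Fock n) :
    Tendsto (fun m => ⟪y, (linearForm z ^ m).1 x⟫_ℂ) atTop (𝓝 0) := by
  refine tendsto_iff_ultrafilter _ _ _ |>.2 fun U hU => ?_
  obtain ⟨v, -, hv⟩ := exists_forall_tendsto_inner (𝕜 := ℂ) U
    fun m => norm_linearForm_pow_apply_le hz m x
  have hv0 : v = 0 := lp.ext <| funext fun w => by
    rw [← inner_basisVec]
    refine tendsto_nhds_unique (hv (basisVec w)) (tendsto_const_nhds.congr' ?_)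
    filter_upwards [hU (eventually_gt_atTop w.length)] with m hm
    rw [inner_basisVec, linearForm_pow_apply_eq_zero z x hm]
    rfl
  simpa [hv0] using hv y

/-! ### Backward shifts and factorization -/

lemma mem_hardy_of_tendsto {α : Type*} {l : Filter α} [l.NeBot] {φ : α → hardy n}
    {T : Fock n →L[ℂ] Fock n}
    (h : ∀ y x, Tendsto (fun a => ⟪y, (φ a).1 x⟫_ℂ) l (𝓝 ⟪y, T x⟫_ℂ)) : T ∈ hardy n := by
  have hlim : Tendsto
      (fun a => (ContinuousLinearMapWOT.ofCLM (φ a).1 : Fock n →WOT[ℂ] Fock n)) l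
      (𝓝 (ContinuousLinearMapWOT.ofCLM T)) :=
    ContinuousLinearMapWOT.tendsto_iff_forall_inner_apply_tendsto.2 fun x y => h y x
  exact (Subalgebra.isClosed_topologicalClosure _).mem_of_tendsto hlim
    (Eventually.of_forall fun a => (φ a).2)

instance : CompleteSpace (hardy n) := by
  have hclosed : IsClosed (hardy n : Set (Fock n →L[ℂ] Fock n)) :=
    (Subalgebra.isClosed_topologicalClosure _).preimage ContinuousLinearMapWOT.continuous_ofCLM
  exact hclosed.completeSpace_coe

instance : NormOneClass (hardy n) where
  norm_one :=
    have : Nontrivial (Fock n) := nontrivial_of_ne _ 0 ((orthonormal_basisVec n).ne_zero [])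
    ContinuousLinearMap.norm_id

lemma norm_eval_le (z : Ball n) (φ : hardy n) : ‖eval z φ‖ ≤ ‖φ‖ :=
  AlgHom.norm_apply_le_self (eval z) φ

lemma hardy_induction {p : (Fock n →L[ℂ] Fock n) → Prop}
    (isClosed : IsClosed {T : Fock n →WOT[ℂ] Fock n | p T.toCLM})
    (algebraMap : ∀ c : ℂ, p (algebraMap ℂ _ c)) (creation : ∀ j, p (creation j))
    (add : ∀ S T, p S → p T → p (S + T))
    (mul : ∀ S ∈ hardy n, ∀ T ∈ hardy n, p S → p T → p (S * T))
    {T : Fock n →L[ℂ] Fock n} (hT : T ∈ hardy n) : p T := by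
  refine closure_minimal (t := {T : Fock n →WOT[ℂ] Fock n | p T.toCLM}) (fun S hS => ?_) isClosed hT
  induction hS using Algebra.adjoin_induction with
  | mem S hS =>
    obtain ⟨j, rfl⟩ := hS
    exact creation j
  | algebraMap c => exact algebraMap c
  | add S T _ _ hS hT => exact add _ _ hS hT
  | mul S T hS' hT' hS hT =>
    exact mul _ (Subalgebra.le_topologicalClosure _ hS') _
      (Subalgebra.le_topologicalClosure _ hT') hS hT

lemma kernelVec_zero : kernelVec ⟨0, by simp⟩ = (basisVec [] : Fock n) := by
  refine lp.ext (funext fun w => ?_)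
  rw [basisVec, lp.coeFn_single]
  cases w <;> simp [kernelVec, monomial]

lemma hardy_apply_nil (φ : hardy n) (x : Fock n) :
    φ.1 x [] = φ.1 (basisVec []) [] * x [] := by
  simpa only [kernelVec_zero, inner_basisVec] using inner_kernelVec_apply ⟨0, by simp⟩ φ x

/-- The operator `S_j^* (T - T(0))`, where `T(0)` is the vacuum expectation of `T`. -/
noncomputable def backwardShiftOp (j : Fin n) :
    (Fock n →L[ℂ] Fock n) →ₗ[ℂ] Fock n →L[ℂ] Fock n where
  toFun T := (creation j).adjoint * (T - T (basisVec []) [] • 1)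
  map_add' S T := by
    rw [← mul_add, add_apply, lp.coeFn_add, Pi.add_apply, add_smul,
      add_sub_add_comm]
  map_smul' c T := by
    rw [RingHom.id_apply, ← mul_smul_comm, smul_apply, lp.coeFn_smul,
      Pi.smul_apply, smul_sub, smul_assoc]

lemma backwardShiftOp_apply (j : Fin n) (T : Fock n →L[ℂ] Fock n) (x : Fock n) :
    backwardShiftOp j T x = (creation j).adjoint (T x - T (basisVec []) [] • x) :=
  rfl

lemma continuous_backwardShiftOp (j : Fin n) :
    Continuous fun T : Fock n →WOT[ℂ] Fock n =>
      (ContinuousLinearMapWOT.ofCLM (backwardShiftOp j T.toCLM) : Fock n →WOT[ℂ] Fock n) := by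
  refine ContinuousLinearMapWOT.continuous_iff.2 fun x y => ?_
  have hinner (T : Fock n →WOT[ℂ] Fock n) : ⟪y, backwardShiftOp j T.toCLM x⟫_ℂ =
      ⟪creation j y, T x⟫_ℂ - ⟪basisVec [], T (basisVec [])⟫_ℂ * ⟪creation j y, x⟫_ℂ := by
    rw [backwardShiftOp_apply, ContinuousLinearMap.adjoint_inner_right, inner_sub_right,
      inner_smul_right, inner_basisVec]
    rfl
  have hcont (u v : Fock n) : Continuous fun T : Fock n →WOT[ℂ] Fock n => ⟪v, T u⟫_ℂ :=
    ContinuousLinearMapWOT.continuous_iff.1 continuous_id u v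
  exact ((hcont _ _).sub ((hcont _ _).mul continuous_const)).congr fun T => (hinner T).symm

lemma backwardShiftOp_algebraMap (j : Fin n) (c : ℂ) :
    backwardShiftOp j (algebraMap ℂ _ c) = 0 := by
  ext1 x
  rw [backwardShiftOp_apply]
  simp [Algebra.algebraMap_eq_smul_one, basisVec]

lemma backwardShiftOp_creation (i j : Fin n) :
    backwardShiftOp i (creation j) = if i = j then 1 else 0 := by
  ext1 x
  rw [backwardShiftOp_apply, creation_apply_nil, zero_smul, sub_zero, adjoint_creation_creation]
  split_ifs <;> rfl

lemma backwardShiftOp_mul (j : Fin n) {S : Fock n →L[ℂ] Fock n} (hS : S ∈ hardy n)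
    (T : Fock n →L[ℂ] Fock n) :
    backwardShiftOp j (S * T) = backwardShiftOp j S * T +
      S (basisVec []) [] • backwardShiftOp j T := by
  ext1 x
  have hST : (S * T) (basisVec []) [] = S (basisVec []) [] * T (basisVec []) [] :=
    hardy_apply_nil ⟨S, hS⟩ _
  rw [add_apply, smul_apply, mul_apply_eq_comp, backwardShiftOp_apply, backwardShiftOp_apply,
    backwardShiftOp_apply, hST, ← map_smul (creation j).adjoint, ← map_add, mul_apply_eq_comp,
    smul_sub, smul_smul, sub_add_sub_cancel]

lemma backwardShiftOp_mem_hardy (j : Fin n) {T : Fock n →L[ℂ] Fock n} (hT : T ∈ hardy n) :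
    backwardShiftOp j T ∈ hardy n := by
  apply hardy_induction (p := fun T => backwardShiftOp j T ∈ hardy n) (hT := hT)
  case isClosed =>
    exact (Subalgebra.isClosed_topologicalClosure _).preimage (continuous_backwardShiftOp j)
  case algebraMap => exact fun c => backwardShiftOp_algebraMap j c ▸ zero_mem _
  case creation =>
    intro i
    rw [backwardShiftOp_creation]
    split_ifs
    exacts [one_mem _, zero_mem _]
  case add => exact fun S T hS hT => map_add (backwardShiftOp j) S T ▸ add_mem hS hT
  case mul =>
    intro S hS T hT hS' hT'
    rw [backwardShiftOp_mul j hS]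
    exact add_mem (mul_mem hS' hT) (Subalgebra.smul_mem _ hT' _)

lemma norm_apply_vacuum_le (φ : hardy n) : ‖φ.1 (basisVec [])‖ ≤ ‖φ‖ := by
  refine (φ.1.le_opNorm (basisVec [])).trans_eq ?_
  rw [(orthonormal_basisVec n).1 [], mul_one]
  rfl

/-- The backward shift `φ ↦ S_j^* (φ - φ(0))` of `Fₙ^∞`. -/
noncomputable def backwardShift (j : Fin n) : hardy n →L[ℂ] hardy n :=
  LinearMap.mkContinuous
    ((backwardShiftOp j).restrict (p := Subalgebra.toSubmodule (hardy n))
      (q := Subalgebra.toSubmodule (hardy n)) fun _ => backwardShiftOp_mem_hardy j) 2 fun φ => by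
    refine ContinuousLinearMap.opNorm_le_bound _ (by positivity) fun x => ?_
    change ‖(creation j).adjoint (φ.1 x - φ.1 (basisVec []) [] • x)‖ ≤ _
    refine (norm_adjoint_creation_apply_le j _).trans ((norm_sub_le _ _).trans ?_)
    have hφ : ‖φ.1 (basisVec []) []‖ ≤ ‖φ‖ :=
      (lp.norm_apply_le_norm two_ne_zero _ _).trans (norm_apply_vacuum_le φ)
    rw [two_mul, add_mul, norm_smul]
    exact add_le_add (φ.1.le_opNorm x) (mul_le_mul_of_nonneg_right hφ (norm_nonneg x))

lemma eq_algebraMap_add_sum_gen_mul_backwardShift (φ : hardy n) :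
    φ = algebraMap ℂ _ (φ.1 (basisVec []) []) + ∑ j, gen j * backwardShift j φ := by
  refine Subtype.ext (ContinuousLinearMap.ext fun x => ?_)
  have hx : (φ.1 x - φ.1 (basisVec []) [] • x) [] = 0 := by
    change φ.1 x [] - φ.1 (basisVec []) [] * x [] = 0
    rw [hardy_apply_nil, sub_self]
  have hsum : (∑ j, gen j * backwardShift j φ).1 x = φ.1 x - φ.1 (basisVec []) [] • x := by
    rw [AddSubmonoidClass.coe_finsetSum, sum_apply]
    exact sum_creation_adjoint_creation hx
  refine (add_sub_cancel (φ.1 (basisVec []) [] • x) (φ.1 x)).symm.trans ?_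
  rw [← hsum]
  rfl

/-- The operator `∑ j, z_j B_j` on `Fₙ^∞`, where `B_j` are the backward shifts. -/
noncomputable def backwardShiftSum (z : Cn n) : hardy n →L[ℂ] hardy n :=
  ∑ j, z j • backwardShift j

lemma backwardShiftSum_apply (z : Cn n) (φ : hardy n) (x : Fock n) :
    (backwardShiftSum z φ).1 x =
      (linearForm z).1.adjoint (φ.1 x - φ.1 (basisVec []) [] • x) := by
  have hadj : (linearForm z).1.adjoint = ∑ j, z j • (creation j).adjoint := by
    simp only [linearForm, gen, AddSubmonoidClass.coe_finsetSum, SetLike.val_smul, map_sum,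
      map_smulₛₗ, starRingEnd_self_apply]
  rw [hadj, backwardShiftSum, sum_apply, sum_apply, AddSubmonoidClass.coe_finsetSum, sum_apply]
  rfl

lemma norm_adjoint_linearForm_apply_le (z : Cn n) (x : Fock n) :
    ‖(linearForm z).1.adjoint x‖ ≤ ‖z‖ * ‖x‖ := by
  refine ContinuousLinearMap.le_of_opNorm_le _ ?_ x
  rw [LinearIsometryEquiv.norm_map]
  exact norm_linearForm_le z

lemma norm_backwardShiftSum_apply_le (z : Cn n) (φ : hardy n) :
    ‖backwardShiftSum z φ‖ ≤ ‖z‖ * (‖φ‖ + ‖φ.1 (basisVec [])‖) := by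
  refine ContinuousLinearMap.opNorm_le_bound _ (by positivity) fun x => ?_
  refine (congrArg norm (backwardShiftSum_apply z φ x)).trans_le ?_
  rw [mul_assoc]
  refine (norm_adjoint_linearForm_apply_le z _).trans ?_
  gcongr
  rw [add_mul]
  refine (norm_sub_le _ _).trans (add_le_add (φ.1.le_opNorm x) ?_)
  rw [norm_smul]
  gcongr
  exact lp.norm_apply_le_norm two_ne_zero _ _

lemma norm_backwardShiftSum_apply_vacuum_le (z : Cn n) (φ : hardy n) :
    ‖(backwardShiftSum z φ).1 (basisVec [])‖ ≤ ‖z‖ * ‖φ.1 (basisVec [])‖ := by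
  have hvac : (linearForm z).1.adjoint (basisVec []) = 0 := ext_inner_right ℂ fun x => by
    rw [ContinuousLinearMap.adjoint_inner_left, inner_basisVec, linearForm_apply_nil,
      inner_zero_left]
  rw [backwardShiftSum_apply, map_sub, map_smul, hvac, smul_zero, sub_zero]
  exact norm_adjoint_linearForm_apply_le z _

-- The operator norm of `backwardShiftSum z` may exceed `1`. What makes its powers summable is that
-- it shrinks the vector `φ(1)`, the extra term of `norm_backwardShiftSum_apply_le`, by `‖z‖`.
lemma norm_iterate_backwardShiftSum_apply_vacuum_le (z : Cn n) (φ : hardy n) (m : ℕ) :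
    ‖((backwardShiftSum z)^[m] φ).1 (basisVec [])‖ ≤ ‖z‖ ^ m * ‖φ‖ := by
  induction m with
  | zero =>
    rw [pow_zero, one_mul]
    exact norm_apply_vacuum_le φ
  | succ m ih =>
    rw [Function.iterate_succ_apply', pow_succ', mul_assoc]
    refine (norm_backwardShiftSum_apply_vacuum_le z _).trans ?_
    gcongr

lemma norm_iterate_backwardShiftSum_le (z : Cn n) (φ : hardy n) (m : ℕ) :
    ‖(backwardShiftSum z)^[m] φ‖ ≤ (m + 1) * ‖z‖ ^ m * ‖φ‖ := by
  induction m with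
  | zero => simp
  | succ m ih =>
    rw [Function.iterate_succ_apply']
    refine (norm_backwardShiftSum_apply_le z _).trans ?_
    calc _ ≤ ‖z‖ * ((m + 1) * ‖z‖ ^ m * ‖φ‖ + ‖z‖ ^ m * ‖φ‖) := by
          gcongr
          exact norm_iterate_backwardShiftSum_apply_vacuum_le z φ m
      _ = _ := by
          push_cast
          ring

lemma exists_sub_backwardShiftSum_eq {z : Cn n} (hz : ‖z‖ < 1) (φ : hardy n) :
    ∃ ψ, ψ - backwardShiftSum z ψ = φ := by
  have hgeom := summable_geometric_of_lt_one (norm_nonneg z) hz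
  have hlin := summable_pow_mul_geometric_of_norm_lt_one 1 (r := ‖z‖) (by simpa using hz)
  have hsum : Summable fun m : ℕ => (m + 1) * ‖z‖ ^ m * ‖φ‖ :=
    ((hlin.add hgeom).mul_right ‖φ‖).congr fun m => by ring
  exact exists_sub_apply_eq_of_summable_iterate _
    (Summable.of_norm_bounded hsum (norm_iterate_backwardShiftSum_le z φ))

/-- Expanding `ψ = (1 - ∑ j, z_j B_j)⁻¹ φ` along the backward shifts `B_j` gives the factorization
of `φ`. -/
lemma exists_eq_algebraMap_add_sum_mul {z : Cn n} (hz : ‖z‖ < 1) (φ : hardy n) :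
    ∃ (c : ℂ) (χ : Fin n → hardy n),
      φ = algebraMap ℂ _ c + ∑ j, (gen j - algebraMap ℂ _ (z j)) * χ j := by
  obtain ⟨ψ, hψ⟩ := exists_sub_backwardShiftSum_eq hz φ
  refine ⟨ψ.1 (basisVec []) [], fun j => backwardShift j ψ, ?_⟩
  have hsum : backwardShiftSum z ψ = ∑ j, algebraMap ℂ (hardy n) (z j) * backwardShift j ψ := by
    rw [backwardShiftSum, sum_apply]
    exact Finset.sum_congr rfl fun j _ => by rw [smul_apply, Algebra.smul_def]
  rw [← hψ, hsum]
  nth_rewrite 1 [eq_algebraMap_add_sum_gen_mul_backwardShift ψ]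
  rw [add_sub_assoc, ← Finset.sum_sub_distrib]
  simp only [sub_mul]

theorem eq_eval_of_map_gen {ρ : hardy n →ₐ[ℂ] ℂ} {z : Ball n} (hρ : ∀ j, ρ (gen j) = z.1 j) :
    ρ = eval z := by
  ext φ
  obtain ⟨c, χ, rfl⟩ := exists_eq_algebraMap_add_sum_mul (mem_ball_zero_iff.1 z.2) φ
  simp only [map_algebraMap_add_sum_sub_mul, hρ, eval_gen, sub_self, zero_mul]

lemma continuous_eval_apply (φ : hardy n) : Continuous fun z : Ball n => eval z φ := by
  refine continuous_iff_continuousAt.2 fun z => ?_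
  obtain ⟨c, χ, rfl⟩ := exists_eq_algebraMap_add_sum_mul (mem_ball_zero_iff.1 z.2) φ
  simp only [ContinuousAt, map_algebraMap_add_sum_sub_mul, eval_gen, sub_self, zero_mul]
  refine tendsto_const_nhds.add (tendsto_finsetSum _ fun j _ => ?_)
  refine Tendsto.zero_mul_isBoundedUnder_le ?_
    (isBoundedUnder_of ⟨‖χ j‖, fun w => norm_eval_le w (χ j)⟩)
  have hj : Continuous fun w : Ball n => w.1 j - z.1 j := by fun_prop
  simpa using hj.tendsto z

/-! ### Weak* continuous characters -/

lemma norm_inner_apply_le (φ : hardy n) (x y : Fock n) :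
    ‖⟪y, φ.1 x⟫_ℂ‖ ≤ ‖y‖ * ‖x‖ * ‖φ‖ := by
  calc ‖⟪y, φ.1 x⟫_ℂ‖ ≤ ‖y‖ * ‖φ.1 x‖ := norm_inner_le_norm _ _
    _ ≤ ‖y‖ * (‖φ‖ * ‖x‖) := by
        gcongr
        exact φ.1.le_opNorm x
    _ = ‖y‖ * ‖x‖ * ‖φ‖ := by ring

lemma add_mem_predual {f g : hardy n →ₗ[ℂ] ℂ} (hf : f ∈ predual n) (hg : g ∈ predual n) :
    f + g ∈ predual n := by
  obtain ⟨x, y, hx, hy, hf⟩ := hf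
  obtain ⟨x', y', hx', hy', hg⟩ := hg
  obtain ⟨e⟩ : Nonempty (ℕ ⊕ ℕ ≃ ℕ) := ⟨Equiv.natSumNatEquivNat⟩
  refine ⟨Sum.elim x x' ∘ e.symm, Sum.elim y y' ∘ e.symm, ?_, ?_, fun φ => ?_⟩
  · rw [← e.summable_iff]
    exact Summable.sum _ (by simpa [Function.comp_def] using hx)
      (by simpa [Function.comp_def] using hx')
  · rw [← e.summable_iff]
    exact Summable.sum _ (by simpa [Function.comp_def] using hy)
      (by simpa [Function.comp_def] using hy')
  · have hsum := Summable.of_norm_bounded ((summable_norm_mul_norm hy hx).mul_right ‖φ‖)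
      fun k => norm_inner_apply_le φ (x k) (y k)
    have hsum' := Summable.of_norm_bounded ((summable_norm_mul_norm hy' hx').mul_right ‖φ‖)
      fun k => norm_inner_apply_le φ (x' k) (y' k)
    have hfg : HasSum (fun s => ⟪Sum.elim y y' s, φ.1 (Sum.elim x x' s)⟫_ℂ) (f φ + g φ) := by
      rw [hf, hg]
      exact HasSum.sum hsum.hasSum hsum'.hasSum
    rw [← e.tsum_eq]
    simpa using hfg.tsum_eq.symm

lemma smul_mem_predual (a : ℂ) {f : hardy n →ₗ[ℂ] ℂ} (hf : f ∈ predual n) :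
    a • f ∈ predual n := by
  obtain ⟨x, y, hx, hy, hf⟩ := hf
  refine ⟨fun k => a • x k, y, ?_, hy, fun φ => ?_⟩
  · simpa only [norm_smul, mul_pow] using hx.mul_left (‖a‖ ^ 2)
  · simp only [LinearMap.smul_apply, hf, map_smul, inner_smul_right, tsum_mul_left, smul_eq_mul]

/-- The predual of `Fₙ^∞`, as a linear space of functionals. -/
def predualSubmodule (n : ℕ) : Submodule ℂ (hardy n →ₗ[ℂ] ℂ) where
  carrier := predual n
  add_mem' := add_mem_predual
  zero_mem' := ⟨0, 0, by simp, by simp, by simp⟩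
  smul_mem' := fun a _ => smul_mem_predual a

lemma eval_mem_predual (z : Ball n) : (eval z).toLinearMap ∈ predual n := by
  refine ⟨Pi.single 0 (basisVec []), Pi.single 0 (kernelVec z), ?_, ?_, fun φ => ?_⟩
  · exact summable_of_ne_finset_zero (s := {0}) fun k hk => by simp_all
  · exact summable_of_ne_finset_zero (s := {0}) fun k hk => by simp_all
  · rw [tsum_eq_single 0 fun k hk => by simp [hk], Pi.single_eq_same, Pi.single_eq_same]
    rfl

lemma tendsto_of_mem_predual {α : Type*} {l : Filter α} {f : hardy n →ₗ[ℂ] ℂ}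
    (hf : f ∈ predual n) {φ : α → hardy n} {ψ : hardy n} {C : ℝ} (hC : ∀ a, ‖φ a‖ ≤ C)
    (h : ∀ y x, Tendsto (fun a => ⟪y, (φ a).1 x⟫_ℂ) l (𝓝 ⟪y, ψ.1 x⟫_ℂ)) :
    Tendsto (fun a => f (φ a)) l (𝓝 (f ψ)) := by
  obtain ⟨x, y, hx, hy, hf⟩ := hf
  simp only [hf]
  refine tendsto_tsum_of_dominated_convergence ((summable_norm_mul_norm hy hx).mul_right C)
    (fun k => h (y k) (x k)) (Eventually.of_forall fun a k => ?_)
  refine (norm_inner_apply_le (φ a) (x k) (y k)).trans ?_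
  gcongr
  exact hC a

lemma continuous_weakStar_iff (J : Ideal (hardy n)) [J.IsTwoSided]
    (π : (hardy n ⧸ J) →ₗ[ℂ] ℂ) :
    @Continuous _ _ (weakStar J) inferInstance π ↔
      π ∘ₗ (Ideal.Quotient.mkₐ ℂ J).toLinearMap ∈ predual n := by
  let A : Submodule ℂ ((hardy n ⧸ J) →ₗ[ℂ] ℂ) :=
    (predualSubmodule n).comap (LinearMap.lcomp ℂ ℂ (Ideal.Quotient.mkₐ ℂ J).toLinearMap)
  have hA : weakStar J = ⨅ g : A, TopologicalSpace.induced g.1 inferInstance :=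
    iInf_subtype' (p := (· ∈ A)) (f := fun g _ => TopologicalSpace.induced g inferInstance)
  rw [hA, ← LinearMap.mem_span_iff_continuous (f := fun g : A => g.1)]
  have hspan : Submodule.span ℂ (Set.range fun g : A => g.1) = A :=
    (congrArg (Submodule.span ℂ) Subtype.range_coe).trans (Submodule.span_eq A)
  rw [hspan]
  rfl

lemma exists_ball_forall_map_gen {ρ : hardy n →ₐ[ℂ] ℂ} (hρ : ρ.toLinearMap ∈ predual n) :
    ∃ z : Ball n, ∀ j, ρ (gen j) = z.1 j := by
  let z : Cn n := WithLp.toLp 2 fun j => ρ (gen j)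
  obtain ⟨c, hc, hcz⟩ := exists_norm_le_one_inner_eq_norm (𝕜 := ℂ) z
  have hpow : Tendsto (fun m => ρ (linearForm c ^ m)) atTop (𝓝 (ρ 0)) := by
    refine tendsto_of_mem_predual hρ (C := 1) (fun m => ?_) fun y x => ?_
    · exact ContinuousLinearMap.opNorm_le_bound _ zero_le_one fun x =>
        (norm_linearForm_pow_apply_le hc m x).trans_eq (one_mul _).symm
    · simpa using tendsto_inner_linearForm_pow hc x y
  have hz : Tendsto (fun m : ℕ => ‖z‖ ^ m) atTop (𝓝 0) := by
    simpa [map_linearForm ρ (w := z) fun _ => rfl, hcz] using hpow.norm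
  exact ⟨⟨z, by simpa [tendsto_pow_atTop_nhds_zero_iff] using hz⟩, fun _ => rfl⟩

theorem exists_eq_eval_of_mem_predual {ρ : hardy n →ₐ[ℂ] ℂ} (hρ : ρ.toLinearMap ∈ predual n) :
    ∃ z : Ball n, ρ = eval z := by
  obtain ⟨z, hz⟩ := exists_ball_forall_map_gen hρ
  exact ⟨z, eq_eval_of_map_gen hz⟩

/-- The common zero set in the ball of an ideal of `Fₙ^∞`. -/
def zeroLocus (J : Ideal (hardy n)) : Set (Ball n) :=
  {z | ∀ φ ∈ J, eval z φ = 0}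

section Spectrum

variable {J : Ideal (hardy n)} [J.IsTwoSided]

/-- The element of the spectrum of `Fₙ^∞ / J` given by evaluation at a common zero of `J`. -/
noncomputable def evalSpec (z : zeroLocus J) : Spec J where
  val := Ideal.Quotient.liftₐ J (eval z.1) z.2
  property := (continuous_weakStar_iff J
    (Ideal.Quotient.liftₐ J (eval z.1) z.2).toLinearMap).2 (eval_mem_predual z.1)

lemma evalSpec_mk (z : zeroLocus J) (φ : hardy n) :
    (evalSpec z).1 (Ideal.Quotient.mk J φ) = eval z.1 φ :=
  rfl

lemma continuous_evalSpec : Continuous (evalSpec (J := J)) := by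
  refine continuous_induced_rng.2 (continuous_pi fun a => ?_)
  obtain ⟨φ, rfl⟩ := Ideal.Quotient.mk_surjective a
  exact (continuous_eval_apply φ).comp continuous_subtype_val

lemma evalSpec_surjective : Function.Surjective (evalSpec (J := J)) := by
  intro π
  obtain ⟨z, hz⟩ := exists_eq_eval_of_mem_predual (ρ := π.1.comp (Ideal.Quotient.mkₐ ℂ J))
    ((continuous_weakStar_iff J π.1.toLinearMap).1 π.2)
  have hz (φ : hardy n) : π.1 (Ideal.Quotient.mk J φ) = eval z φ := congr($hz φ)
  refine ⟨⟨z, fun φ hφ => ?_⟩, Subtype.ext (AlgHom.ext fun a => ?_)⟩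
  · rw [← hz, Ideal.Quotient.eq_zero_iff_mem.2 hφ]
    exact map_zero π.1
  · obtain ⟨φ, rfl⟩ := Ideal.Quotient.mk_surjective a
    rw [evalSpec_mk, hz]

/-- The point `(π(S₁ + J), …, π(Sₙ + J))` of `ℂⁿ` that represents an element `π` of the
spectrum. -/
noncomputable def Spec.toPoint (π : Spec J) : Cn n :=
  WithLp.toLp 2 fun j => π.1 (Ideal.Quotient.mk J (gen j))

lemma Spec.continuous_toPoint : Continuous (Spec.toPoint (J := J)) :=
  (PiLp.continuous_toLp 2 _).comp <| continuous_pi fun j =>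
    (continuous_apply (Ideal.Quotient.mk J (gen j))).comp continuous_induced_dom

lemma toPoint_evalSpec (z : zeroLocus J) : (evalSpec z).toPoint = z.1.1 :=
  PiLp.ext fun j => eval_gen z.1 j

lemma isEmbedding_evalSpec : IsEmbedding (evalSpec (J := J)) := by
  refine .of_comp continuous_evalSpec Spec.continuous_toPoint ?_
  have hval : Spec.toPoint ∘ evalSpec (J := J) = Subtype.val ∘ Subtype.val :=
    funext toPoint_evalSpec
  exact hval ▸ IsEmbedding.subtypeVal.comp IsEmbedding.subtypeVal

/-- The homeomorphism of the common zero set of `J` onto the spectrum of `Fₙ^∞ / J` that sends a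
point to the evaluation at it. -/
noncomputable def zeroLocusHomeomorphSpec (J : Ideal (hardy n)) [J.IsTwoSided] :
    zeroLocus J ≃ₜ Spec J :=
  isEmbedding_evalSpec.toHomeomorphOfSurjective evalSpec_surjective

end Spectrum

theorem spectralClosure_eq_image_zeroLocus (Δ : Set (Ball n)) :
    spectralClosure Δ = Subtype.val '' zeroLocus (nevanlinna Δ) := by
  have hrange : spectralClosure Δ = Set.range (Spec.toPoint (J := nevanlinna Δ)) :=
    Set.ext fun w => exists_congr fun π => ⟨fun h => PiLp.ext h, fun h j => congr($h j)⟩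
  rw [hrange, ← evalSpec_surjective.range_comp, Set.image_eq_range]
  exact congrArg Set.range (funext toPoint_evalSpec)

/-! ### Blaschke products -/

lemma eval_linearForm (w : Ball n) (c : Cn n) : eval w (linearForm c) = ⟪c, w.1⟫_ℂ :=
  map_linearForm (eval w) (eval_gen w) c

lemma exists_eval_mul_one_sub_conj_inner_eq (p : Ball n) {c : Cn n} (hc : ‖c‖ ≤ 1) :
    ∃ b : hardy n, ‖b‖ ≤ 1 ∧ eval p b = 0 ∧ ∀ w : Ball n,
      eval w b * (1 - conj ⟪c, p.1⟫_ℂ * ⟪c, w.1⟫_ℂ) = ⟪c, p.1⟫_ℂ - ⟪c, w.1⟫_ℂ := by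
  set a := ⟪c, p.1⟫_ℂ
  have ha : ‖a‖ < 1 := (norm_inner_le_norm _ _).trans_lt <|
    (mul_le_of_le_one_left (norm_nonneg _) hc).trans_lt (mem_ball_zero_iff.1 p.2)
  obtain ⟨b, hb, hmul⟩ :=
    exists_mul_one_sub_conj_smul_eq ((norm_linearForm_le c).trans hc) ha
  have heval (w : Ball n) : eval w b * (1 - conj a * ⟪c, w.1⟫_ℂ) = a - ⟪c, w.1⟫_ℂ := by
    have hsmul : eval w (conj a • linearForm c) = conj a * ⟪c, w.1⟫_ℂ :=
      ((eval w).toLinearMap.map_smul _ _).trans (congrArg (conj a * ·) (eval_linearForm w c))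
    have hw := congrArg (eval w) hmul
    rwa [map_mul, map_sub, map_one, hsmul, map_sub, AlgHom.commutes, eval_linearForm] at hw
  refine ⟨b, hb, ?_, heval⟩
  have hne : 1 - conj a * a ≠ 0 := by
    rw [Complex.conj_mul', sub_ne_zero]
    exact_mod_cast (pow_lt_one₀ (norm_nonneg a) ha two_ne_zero).ne'
  exact (mul_eq_zero.1 ((heval p).trans (sub_self a))).resolve_right hne

lemma exists_eval_eq_zero_and_one_sub_norm_eval_le {p z : Ball n} (hpz : p ≠ z) :
    ∃ b : hardy n, ‖b‖ ≤ 1 ∧ eval p b = 0 ∧ eval z b ≠ 0 ∧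
      1 - ‖eval z b‖ ≤ 2 / (1 - ‖z.1‖) * (1 - ‖p.1‖) := by
  have hz : ‖z.1‖ < 1 := mem_ball_zero_iff.1 z.2
  rcases lt_or_ge (2 / (1 - ‖z.1‖) * (1 - ‖p.1‖)) 1 with hlt | hge
  · obtain ⟨c, hc, hcp⟩ := exists_norm_le_one_inner_eq_norm (𝕜 := ℂ) p.1
    obtain ⟨b, hb, hpb, heval⟩ := exists_eval_mul_one_sub_conj_inner_eq p hc
    have hcz : ‖⟪c, z.1⟫_ℂ‖ ≤ ‖z.1‖ :=
      (norm_inner_le_norm _ _).trans (mul_le_of_le_one_left (norm_nonneg _) hc)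
    have hle : 1 - ‖eval z b‖ ≤ 2 / (1 - ‖z.1‖) * (1 - ‖p.1‖) := by
      refine one_sub_norm_le_of_mul_one_sub_eq (norm_nonneg _) (mem_ball_zero_iff.1 p.2).le
        hcz hz ?_
      simpa [hcp] using heval z
    exact ⟨b, hb, hpb, norm_pos_iff.1 (by linarith), hle⟩
  · obtain ⟨c, hc, hcpz⟩ := exists_norm_le_one_inner_eq_norm (𝕜 := ℂ) (p.1 - z.1)
    obtain ⟨b, hb, hpb, heval⟩ := exists_eval_mul_one_sub_conj_inner_eq p hc
    refine ⟨b, hb, hpb, fun hzb => hpz (Subtype.ext ?_), ?_⟩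
    · have hzero : ⟪c, p.1 - z.1⟫_ℂ = 0 := by
        rw [inner_sub_right, ← heval z, hzb, zero_mul]
      rw [hcpz] at hzero
      exact sub_eq_zero.1 (norm_eq_zero.1 (RCLike.ofReal_eq_zero.1 hzero))
    · exact (sub_le_self 1 (norm_nonneg _)).trans hge

lemma exists_eval_eq_prod {ι : Type*} {a : ι → hardy n} (ha : ∀ i, ‖a i‖ ≤ 1) (s : Finset ι) :
    ∃ φ : hardy n, ‖φ‖ ≤ 1 ∧ ∀ w, eval w φ = ∏ i ∈ s, eval w (a i) := by
  refine ⟨(s.toList.map a).prod, ?_, fun w => ?_⟩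
  · refine (List.norm_prod_le (s.toList.map a)).trans ?_
    rw [List.map_map, Finset.prod_map_toList]
    exact Finset.prod_le_one (fun i _ => norm_nonneg _) fun i _ => ha i
  · rw [map_list_prod, List.map_map, Finset.prod_map_toList]
    rfl

-- `φ` is a cluster point of the finite products of the `a i`, in the weak operator topology.
lemma exists_eval_ne_zero_of_summable {ι : Type*} {a : ι → hardy n} (ha : ∀ i, ‖a i‖ ≤ 1)
    {z : Ball n} (hz : ∀ i, eval z (a i) ≠ 0) (hsum : Summable fun i => 1 - ‖eval z (a i)‖) :
    ∃ φ : hardy n, eval z φ ≠ 0 ∧ ∀ w i, eval w (a i) = 0 → eval w φ = 0 := by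
  obtain ⟨δ, hδ, hprod⟩ := exists_pos_forall_le_prod (fun i => norm_pos_iff.2 (hz i))
    (fun i => (norm_eval_le z _).trans (ha i)) hsum
  choose ψ hψ heval using exists_eval_eq_prod ha
  let U : Ultrafilter (Finset ι) := Ultrafilter.of atTop
  obtain ⟨T, hT⟩ := exists_forall_tendsto_inner_apply U hψ
  let φ : hardy n := ⟨T, mem_hardy_of_tendsto hT⟩
  have hlim (w : Ball n) : Tendsto (fun s => eval w (ψ s)) U (𝓝 (eval w φ)) :=
    hT (kernelVec w) (basisVec [])
  refine ⟨φ, norm_pos_iff.1 (hδ.trans_le (ge_of_tendsto' (hlim z).norm fun s => ?_)),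
    fun w i hi => ?_⟩
  · rw [heval, norm_prod]
    exact hprod s
  · have hzero : ∀ᶠ s in U, eval w (ψ s) = 0 :=
      Ultrafilter.of_le _ <| (eventually_ge_atTop {i}).mono fun s hs =>
        (heval s w).trans (Finset.prod_eq_zero (Finset.singleton_subset_iff.1 hs) hi)
    exact tendsto_nhds_unique (hlim w) (tendsto_const_nhds.congr' (hzero.mono fun _ h => h.symm))

theorem exists_mem_nevanlinna_range_eval_ne_zero {ι : Type*} {p : ι → Ball n}
    (hp : Summable fun i => 1 - ‖(p i).1‖) {z : Ball n} (hz : z ∉ Set.range p) :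
    ∃ φ ∈ nevanlinna (Set.range p), eval z φ ≠ 0 := by
  choose a ha hpa hza hle using fun i =>
    exists_eval_eq_zero_and_one_sub_norm_eval_le fun h : p i = z => hz ⟨i, h⟩
  have hsum : Summable fun i => 1 - ‖eval z (a i)‖ :=
    .of_nonneg_of_le (fun i => sub_nonneg.2 ((norm_eval_le z _).trans (ha i))) hle (hp.mul_left _)
  obtain ⟨φ, hzφ, hφ⟩ := exists_eval_ne_zero_of_summable ha hza hsum
  exact ⟨φ, Set.forall_mem_range.2 fun i => hφ (p i) i (hpa i), hzφ⟩

theorem zeroLocus_nevanlinna_range {ι : Type*} {p : ι → Ball n}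
    (hp : Summable fun i => 1 - ‖(p i).1‖) :
    zeroLocus (nevanlinna (Set.range p)) = Set.range p := by
  refine Set.Subset.antisymm (fun z hz => ?_) fun z hz φ hφ => hφ z hz
  by_contra hzp
  obtain ⟨φ, hφ, hzφ⟩ := exists_mem_nevanlinna_range_eval_ne_zero hp hzp
  exact hzφ (hz φ hφ)

end NCHardy

theorem mainTheorem3 (n : ℕ) (hn : 0 < n) {ι : Type*} (lam : ι → NCHardy.Ball n)
    (hlam : Summable fun i => 1 - ‖(lam i : NCHardy.Cn n)‖) :
    (∃ h : Set.range lam ≃ₜ NCHardy.Spec (NCHardy.nevanlinna (Set.range lam)),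
      ∀ (z : Set.range lam) (φ : NCHardy.hardy n),
        (h z).1 (Ideal.Quotient.mk (NCHardy.nevanlinna (Set.range lam)) φ) =
          NCHardy.eval z.1 φ) ∧
    NCHardy.spectralClosure (Set.range lam) = Subtype.val '' Set.range lam := by
  have hzero := NCHardy.zeroLocus_nevanlinna_range hlam
  constructor
  · exact ⟨(Homeomorph.setCongr hzero.symm).trans (NCHardy.zeroLocusHomeomorphSpec _),
      fun z φ => rfl⟩
  · rw [NCHardy.spectralClosure_eq_image_zeroLocus, hzero]
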